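/- Let $A=(a_{ij})$ be an integer $r\times N$ matrix with $N>r$ and pairwise distinct columns $\mathbf a_1,\dots,\mathbf a_N$ that span $\mathbb Z^r$ over $\mathbb Z$, and suppose that some linear form $h$ satisfies $h(\mathbf a_j)=1$ for all $j$. Let $\alpha\in\mathbb R^r$ and $L=\{l\in\mathbb Z^N : l_1\mathbf a_1+\cdots+l_N\mathbf a_N=\mathbf 0\}$. Write $\partial_j=\partial/\partial v_j$. The A-hypergeometric system $H_A(\alpha)$ consists of the homogeneity equations $$\Big(\sum_{j=1}^N a_{ij}v_j\partial_j-\alpha_i\Big)\Phi=0\quad(i=1,\dots,r)$$ and the box equations $$\Big(\prod_{l_j>0}\partial_j^{l_j}-\prod_{l_j<0}\partial_j^{-l_j}\Big)\Phi=0\quad(l\in L).$$ Put $d=N-r$, let $B$ be a $d\times N$ matrix whose rows form a $\mathbb Z$-basis of $L$, and let $\mathbf b_1,\dots,\mathbf b_N$ be its columns. Let $\gamma_1,\dots,\gamma_N$ be real numbers with $\gamma_1\mathbf a_1+\cdots+\gamma_N\mathbf a_N=\alpha$ and $\gamma_j<0$ for all $j$. Let $U\subseteq(\mathbb C^*)^N$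 be open with a continuous choice of $\log v_1,\dots,\log v_N$ on $U$, and put $v_j^z=\exp(z\log v_j)$. If the Mellin–Barnes integral $$M(v_1,\dots,v_N)=\int_{\sqrt{-1}\,\mathbb R^d}\prod_{j=1}^N\Gamma(-\gamma_j-\mathbf b_j\cdot\mathbf s)\,v_j^{\gamma_j+\mathbf b_j\cdot\mathbf s}\,ds_1\wedge\cdots\wedge ds_d$$ converges absolutely for every $v\in U$, then $M$ has complex partial derivatives of all orders on $U$ (it is holomorphic there) and satisfies the A-hypergeometric system $H_A(\alpha)$ on $U$. -/

import Mathlib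

open scoped ContDiff

namespace AHyp

/-- The standing assumptions on the integer `r × N` matrix `A` with columns `a_1, …, a_N`: the
columns are pairwise distinct (they enumerate a set of `N` vectors), there are more than `r` of
them, they span `ℤ^r` over `ℤ`, and they lie on a hyperplane `h = 1` for some linear form `h`. -/
structure IsAMatrix {r N : ℕ} (A : Matrix (Fin r) (Fin N) ℤ) : Prop where
  injective_col : Function.Injective A.col
  lt : r < N
  span_col : Submodule.span ℤ (Set.range A.col) = ⊤
  exists_form : ∃ h : Module.Dual ℝ (Fin r → ℝ), ∀ j, h (fun i => (A i j : ℝ)) = 1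

/-- The lattice `L ⊆ ℤ^N` of integer relations `l_1 a_1 + ⋯ + l_N a_N = 0`. -/
def relationLattice {r N : ℕ} (A : Matrix (Fin r) (Fin N) ℤ) : Submodule ℤ (Fin N → ℤ) :=
  LinearMap.ker A.mulVecLin

/-- `B` is a B-matrix for `A`: its `N - r` rows form a `ℤ`-basis of the lattice of relations. -/
structure IsBMatrix {r N : ℕ} (A : Matrix (Fin r) (Fin N) ℤ)
    (B : Matrix (Fin (N - r)) (Fin N) ℤ) : Prop where
  linearIndependent_row : LinearIndependent ℤ B.row
  span_row : Submodule.span ℤ (Set.range B.row) = relationLattice A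

/-- The complex partial derivative `∂_j`. -/
noncomputable def partialD {N : ℕ} (j : Fin N) (f : (Fin N → ℂ) → ℂ) : (Fin N → ℂ) → ℂ :=
  fun v => fderiv ℂ f v (Pi.single j 1)

/-- The operator `∂_1^{k_1} ⋯ ∂_N^{k_N}`. -/
noncomputable def monomialD {N : ℕ} (k : Fin N → ℕ) (f : (Fin N → ℂ) → ℂ) :
    (Fin N → ℂ) → ℂ :=
  (List.finRange N).foldr (fun j g => (partialD j)^[k j] g) f

/-- The box operator `∏_{l_j > 0} ∂_j^{l_j} - ∏_{l_j < 0} ∂_j^{-l_j}`. -/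
noncomputable def boxOp {N : ℕ} (l : Fin N → ℤ) (f : (Fin N → ℂ) → ℂ) : (Fin N → ℂ) → ℂ :=
  fun v => monomialD (fun j => (l j).toNat) f v - monomialD (fun j => (-l j).toNat) f v

/-- The Euler operator `Z_i = a_{i1} v_1 ∂_1 + ⋯ + a_{iN} v_N ∂_N`. -/
noncomputable def eulerOp {r N : ℕ} (A : Matrix (Fin r) (Fin N) ℤ) (i : Fin r)
    (f : (Fin N → ℂ) → ℂ) : (Fin N → ℂ) → ℂ :=
  fun v => ∑ j, (A i j : ℂ) * v j * partialD j f v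

/-- `Φ` is a solution of the A-hypergeometric system `H_A(α)` on the open set `U`: it has complex
derivatives of all orders on `U` and satisfies the homogeneity and the box equations there. -/
structure IsSolution {r N : ℕ} (A : Matrix (Fin r) (Fin N) ℤ) (α : Fin r → ℝ)
    (U : Set (Fin N → ℂ)) (Φ : (Fin N → ℂ) → ℂ) : Prop where
  contDiffOn : ContDiffOn ℂ ∞ Φ U
  homogeneity : ∀ i, ∀ v ∈ U, eulerOp A i Φ v - (α i : ℂ) * Φ v = 0
  box : ∀ l ∈ relationLattice A, ∀ v ∈ U, boxOp l Φ v = 0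

/-- `logv` is a choice of continuous branches of `log v_1, …, log v_N` on `U`. -/
structure IsLogBranch {N : ℕ} (U : Set (Fin N → ℂ)) (logv : (Fin N → ℂ) → Fin N → ℂ) : Prop where
  continuousOn : ContinuousOn logv U
  exp_eq : ∀ v ∈ U, ∀ j, Complex.exp (logv v j) = v j

/-- The linear form `b_j · s`, where `b_j` is the `j`-th column of `B`. -/
noncomputable def colDot {d N : ℕ} (B : Matrix (Fin d) (Fin N) ℤ) (j : Fin N) (s : Fin d → ℂ) : ℂ :=
  ∑ k, (B k j : ℂ) * s k

/-- The Mellin–Barnes integrand `∏_j Γ(-γ_j - b_j · s) v_j^{γ_j + b_j · s}`, where `w_j` is the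
chosen value of `log v_j`, so that `v_j^z = exp (z w_j)`. -/
noncomputable def mbIntegrand {d N : ℕ} (B : Matrix (Fin d) (Fin N) ℤ) (γ : Fin N → ℝ)
    (w : Fin N → ℂ) (s : Fin d → ℂ) : ℂ :=
  ∏ j, Complex.Gamma (-(γ j : ℂ) - colDot B j s) * Complex.exp (((γ j : ℂ) + colDot B j s) * w j)

/-- The point `√-1 τ` of `√-1 ℝ^d`. -/
noncomputable def imagPoint {d : ℕ} (τ : Fin d → ℝ) : Fin d → ℂ :=
  fun k => Complex.I * (τ k : ℂ)

/-- Absolute convergence of the Mellin–Barnes integral. -/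
def MBConverges {d N : ℕ} (B : Matrix (Fin d) (Fin N) ℤ) (γ : Fin N → ℝ) (w : Fin N → ℂ) : Prop :=
  MeasureTheory.Integrable (fun τ : Fin d → ℝ => mbIntegrand B γ w (imagPoint τ))

/-- The Mellin–Barnes integral `∫_{√-1 ℝ^d} ∏_j Γ(-γ_j - b_j · s) v_j^{γ_j + b_j · s} ds` with
`ds = ds_1 ∧ ⋯ ∧ ds_d`; the substitution `s = √-1 τ` produces the factor `√-1 ^ d`. -/
noncomputable def mbIntegral {d N : ℕ} (B : Matrix (Fin d) (Fin N) ℤ) (γ : Fin N → ℝ)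
    (w : Fin N → ℂ) : ℂ :=
  Complex.I ^ d * ∫ τ : Fin d → ℝ, mbIntegrand B γ w (imagPoint τ)

end AHyp

/-! ### Growth of Γ on vertical lines. -/

namespace Complex

/-! Formally, ∂_j turns Γ(-ζ_j - b_j·s) v_j^{ζ_j + b_j·s} into minus the same factor with ζ_j
replaced by ζ_j - 1, because z Γ(z) = Γ(z+1). Thus ∂^k M_γ = (-1)^{|k|} M_{γ-k}. The Euler equations
hold already for the integrand, since Σ_j a_ij (γ_j + b_j·s) = α_i. For l in L the two box monomials
have the same degree, by the form h, so the signs agree. Their exponents γ - l⁺ and γ - l⁻ differ by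
an integer combination of the rows of B, that is, by a translation of the contour, and no pole lies
between the contours because all exponents stay negative.

The analytic work is to justify this from absolute convergence on U alone. Convergence on an open
set allows each arg v_j to be moved slightly both ways, so the integrand is integrable even after
multiplication by Π_j exp(ε|b_j·τ|) (`isDominated_of_eventually`). Changing the exponents within a
compact set of negative real parts costs only such a factor (`exists_norm_Gamma_sub_le`). One
majorant at γ therefore serves all M_ζ, giving differentiation under the integral
(`hasFDerivAt_mbInt`) and the contour shift (`mbInt_add_realDot`). -/

lemma norm_betaIntegral_le {u v : ℂ} (hu : 0 < u.re) (hv : 0 < v.re) :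
    ‖betaIntegral u v‖ ≤ ‖betaIntegral (u.re : ℂ) (v.re : ℂ)‖ := by
  set g : ℝ → ℝ := fun x => ‖(x : ℂ) ^ ((u.re : ℂ) - 1) * (1 - (x : ℂ)) ^ ((v.re : ℂ) - 1)‖ with hg
  have hgint : IntervalIntegrable g MeasureTheory.volume 0 1 :=
    (betaIntegral_convergent (u := (u.re : ℂ)) (v := (v.re : ℂ)) (by simpa) (by simpa)).norm
  have hbeta : betaIntegral (u.re : ℂ) (v.re : ℂ) = ((∫ x in (0 : ℝ)..1, g x : ℝ) : ℂ) := by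
    rw [betaIntegral, ← intervalIntegral.integral_ofReal]
    refine intervalIntegral.integral_congr fun x hx => ?_
    rw [Set.uIcc_of_le zero_le_one] at hx
    have h1 : (1 : ℂ) - (x : ℂ) = ((1 - x : ℝ) : ℂ) := by push_cast; ring
    have e1 : ((u.re : ℂ) - 1) = ((u.re - 1 : ℝ) : ℂ) := by push_cast; ring
    have e2 : ((v.re : ℂ) - 1) = ((v.re - 1 : ℝ) : ℂ) := by push_cast; ring
    simp only [hg]
    rw [h1, e1, e2, ← ofReal_cpow hx.1, ← ofReal_cpow (sub_nonneg.2 hx.2), ← ofReal_mul,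
      norm_real, Real.norm_of_nonneg]
    exact mul_nonneg (Real.rpow_nonneg hx.1 _) (Real.rpow_nonneg (sub_nonneg.2 hx.2) _)
  have hle : ‖betaIntegral u v‖ ≤ ∫ x in (0 : ℝ)..1, g x := by
    refine intervalIntegral.norm_integral_le_of_norm_le zero_le_one ?_ hgint
    filter_upwards [MeasureTheory.Measure.ae_ne MeasureTheory.volume (1 : ℝ)] with x hx1 hx
    have hx' : 0 < 1 - x := sub_pos.2 (lt_of_le_of_ne hx.2 hx1)
    have h1 : (1 : ℂ) - (x : ℂ) = ((1 - x : ℝ) : ℂ) := by push_cast; ring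
    simp only [hg]
    rw [h1, norm_mul, norm_mul, norm_cpow_eq_rpow_re_of_pos hx.1, norm_cpow_eq_rpow_re_of_pos hx',
      norm_cpow_eq_rpow_re_of_pos hx.1, norm_cpow_eq_rpow_re_of_pos hx']
    simp
  rw [hbeta, norm_real]
  exact hle.trans (le_abs_self _)

/-- Γ(z)Γ(h) = Γ(z+h)B(z,h), and |B(z,h)| is at most its value at the real parts. The constant does
not depend on Im z, so this compares vertical lines without Stirling's formula. -/
lemma norm_Gamma_le_norm_Gamma_add {z h : ℂ} (hz : 0 < z.re) (hh : 0 < h.re) :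
    ‖Gamma z‖ ≤
      ‖Gamma (z.re : ℂ) * Gamma (h.re : ℂ) / Gamma ((z.re : ℂ) + h.re)‖ / ‖Gamma h‖ *
        ‖Gamma (z + h)‖ := by
  have h0 : 0 < ‖Gamma h‖ := norm_pos_iff.2 (Gamma_ne_zero_of_re_pos hh)
  rw [div_mul_eq_mul_div, le_div_iff₀ h0, ← norm_mul, Gamma_mul_Gamma_eq_betaIntegral hz hh,
    norm_mul, mul_comm,
    ← betaIntegral_eq_Gamma_mul_div (z.re : ℂ) (h.re : ℂ) (by simpa) (by simpa)]
  exact mul_le_mul_of_nonneg_right (norm_betaIntegral_le hz hh) (norm_nonneg _)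

/-- The functional equation produces a polynomial in |y|, which the exponential absorbs; each step
of the induction spends half of the remaining ε. -/
lemma exists_norm_Gamma_add_nat_le (n : ℕ) {c ε : ℝ} (hc : 0 < c) (hε : 0 < ε) :
    ∃ C, 0 ≤ C ∧ ∀ y : ℝ,
      ‖Gamma ((c + n : ℝ) - I * y)‖ ≤ C * (‖Gamma (c - I * y)‖ * Real.exp (ε * |y|)) := by
  induction n generalizing c ε with
  | zero =>
    refine ⟨1, zero_le_one, fun y => ?_⟩
    have : 1 ≤ Real.exp (ε * |y|) := Real.one_le_exp (by positivity)
    simpa using le_mul_of_one_le_right (norm_nonneg _) this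
  | succ n ih =>
    obtain ⟨C, hC0, hC⟩ := ih (c := c + 1) (ε := ε / 2) (by linarith) (by linarith)
    refine ⟨C * (c + 2 / ε), by positivity, fun y => ?_⟩
    have hne : (c : ℂ) - I * y ≠ 0 := fun h => hc.ne' (by simpa using congrArg re h)
    have hG : Gamma ((c + 1 : ℝ) - I * y) = (c - I * y) * Gamma (c - I * y) := by
      rw [← Gamma_add_one _ hne]; congr 1; push_cast; ring
    have hn : ‖(c : ℂ) - I * y‖ ≤ c + |y| := by
      refine (norm_sub_le _ _).trans ?_
      simp [abs_of_pos hc]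
    have h1 : 1 ≤ Real.exp (ε / 2 * |y|) := Real.one_le_exp (by positivity)
    have h2 : |y| ≤ 2 / ε * Real.exp (ε / 2 * |y|) := by
      have := Real.add_one_le_exp (ε / 2 * |y|)
      rw [div_mul_eq_mul_div, le_div_iff₀ hε]
      linarith
    have h3 : ‖(c : ℂ) - I * y‖ ≤ (c + 2 / ε) * Real.exp (ε / 2 * |y|) := by
      nlinarith
    have he : Real.exp (ε * |y|) = Real.exp (ε / 2 * |y|) * Real.exp (ε / 2 * |y|) := by
      rw [← Real.exp_add]; ring_nf
    have hcast : (c + (n + 1 : ℕ) : ℝ) = c + 1 + n := by push_cast; ring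
    rw [hcast]
    refine (hC y).trans ?_
    rw [hG, norm_mul, he]
    calc C * (‖(c : ℂ) - I * y‖ * ‖Gamma (c - I * y)‖ * Real.exp (ε / 2 * |y|))
        ≤ C * (((c + 2 / ε) * Real.exp (ε / 2 * |y|)) * ‖Gamma (c - I * y)‖ *
            Real.exp (ε / 2 * |y|)) := by gcongr
      _ = _ := by ring

/-- On a compact subset of the right half plane, `|Γ(ζ - iy)|` is bounded by `|Γ(c - iy)|` up to an
arbitrarily small exponential factor. -/
lemma exists_norm_Gamma_sub_le {Q : Set ℂ} (hQ : IsCompact Q) (hpos : ∀ ζ ∈ Q, 0 < ζ.re)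
    {c ε : ℝ} (hc : 0 < c) (hε : 0 < ε) :
    ∃ C, 0 ≤ C ∧ ∀ ζ ∈ Q, ∀ y : ℝ,
      ‖Gamma (ζ - I * y)‖ ≤ C * (‖Gamma (c - I * y)‖ * Real.exp (ε * |y|)) := by
  obtain ⟨R, hR⟩ := hQ.isBounded.exists_norm_le
  obtain ⟨n, hn⟩ := exists_nat_gt R
  have hlt : ∀ ζ ∈ Q, 0 < c + n - ζ.re := fun ζ hζ => by
    have := (re_le_norm ζ).trans (hR ζ hζ)
    linarith
  obtain ⟨C₁, hC₁0, hC₁⟩ := exists_norm_Gamma_add_nat_le n hc hε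
  have hcG : ∀ s : ℂ, 0 < s.re → ContinuousAt Gamma s := fun s hs =>
    (differentiableAt_Gamma s fun m h => by
      rw [h] at hs; simp at hs; linarith [m.cast_nonneg (α := ℝ)]).continuousAt
  set K : ℂ → ℝ := fun ζ => ‖Gamma (ζ.re : ℂ) * Gamma ((c + n - ζ.re : ℝ) : ℂ) /
    Gamma ((c + n : ℝ) : ℂ)‖ / ‖Gamma ((c + n : ℝ) - ζ)‖ with hK
  have hKc : ContinuousOn K Q := fun ζ hζ => by
    have h1 : ContinuousAt (fun ζ : ℂ => Gamma (ζ.re : ℂ)) ζ :=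
      ContinuousAt.comp (f := fun ζ : ℂ => (ζ.re : ℂ)) (g := Gamma)
        (hcG _ (by simpa using hpos ζ hζ)) (by fun_prop)
    have h2 : ContinuousAt (fun ζ : ℂ => Gamma ((c + n - ζ.re : ℝ) : ℂ)) ζ :=
      ContinuousAt.comp (f := fun ζ : ℂ => ((c + n - ζ.re : ℝ) : ℂ)) (g := Gamma)
        (hcG _ (by simpa using hlt ζ hζ)) (by fun_prop)
    have h3 : ContinuousAt (fun ζ : ℂ => Gamma ((c + n : ℝ) - ζ)) ζ :=
      ContinuousAt.comp (f := fun ζ : ℂ => ((c + n : ℝ) - ζ)) (g := Gamma)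
        (hcG _ (by simpa using hlt ζ hζ)) (by fun_prop)
    refine ContinuousAt.continuousWithinAt (((h1.mul h2).div_const _).norm.div h3.norm ?_)
    exact norm_ne_zero_iff.2 (Gamma_ne_zero_of_re_pos (by simpa using hlt ζ hζ))
  obtain ⟨C₂, hC₂⟩ := hQ.exists_bound_of_continuousOn hKc
  refine ⟨max C₂ 0 * C₁, by positivity, fun ζ hζ y => ?_⟩
  -- This complex increment removes ζ from the right side: z + h = c + n - iy. The bound on Q makes
  -- Re h positive for large n, and the constant `K ζ` is continuous on Q.
  have h := norm_Gamma_le_norm_Gamma_add (z := ζ - I * y) (h := (c + n : ℝ) - ζ)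
    (by simpa using hpos ζ hζ) (by simpa using hlt ζ hζ)
  have e1 : (ζ - I * y).re = ζ.re := by simp
  have e2 : (((c + n : ℝ) : ℂ) - ζ).re = c + n - ζ.re := by simp
  have e3 : ζ - I * y + ((c + n : ℝ) - ζ) = (c + n : ℝ) - I * y := by ring
  have e4 : (ζ.re : ℂ) + ((c + n - ζ.re : ℝ) : ℂ) = ((c + n : ℝ) : ℂ) := by push_cast; ring
  rw [e1, e2, e3, e4] at h
  calc ‖Gamma (ζ - I * y)‖ ≤ K ζ * ‖Gamma ((c + n : ℝ) - I * y)‖ := h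
    _ ≤ max C₂ 0 * (C₁ * (‖Gamma (c - I * y)‖ * Real.exp (ε * |y|))) := by
        gcongr
        · exact ((le_abs_self _).trans (hC₂ ζ hζ)).trans (le_max_left _ _)
        · exact hC₁ y
    _ = _ := by ring

end Complex

/-! ### One factor of the integrand. -/

namespace AHyp

open Complex MeasureTheory Filter Topology

lemma differentiableAt_Gamma_of_re_pos {s : ℂ} (hs : 0 < s.re) : DifferentiableAt ℂ Gamma s :=
  differentiableAt_Gamma s fun m h => by
    rw [h] at hs; simp at hs; linarith [m.cast_nonneg (α := ℝ)]

/-- The factor `Γ(-ζ - iy) v^{ζ + iy}` of the Mellin–Barnes integrand, where `w = log v`. -/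
noncomputable def mbFactor (ζ w : ℂ) (y : ℝ) : ℂ :=
  Gamma (-ζ - I * y) * exp ((ζ + I * y) * w)

/-- The majorant `|Γ(-γ - iy)| exp(-yθ + ε|y|)` of a Mellin–Barnes factor. -/
noncomputable def mbMajorant (γ θ ε y : ℝ) : ℝ :=
  ‖Gamma ((-γ : ℝ) - I * y)‖ * Real.exp (-(y * θ) + ε * |y|)

lemma mbMajorant_nonneg (γ θ ε y : ℝ) : 0 ≤ mbMajorant γ θ ε y := by
  unfold mbMajorant; positivity

lemma continuous_mbFactor {ζ w : ℂ} (hζ : ζ.re < 0) : Continuous (mbFactor ζ w) := by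
  refine Continuous.mul (continuous_iff_continuousAt.2 fun y => ?_) (by fun_prop)
  exact ContinuousAt.comp (f := fun y : ℝ => -ζ - I * y) (g := Gamma)
    (differentiableAt_Gamma_of_re_pos (by simpa using hζ)).continuousAt (by fun_prop)

lemma exp_mul_mbFactor_sub_one {ζ w : ℂ} (hζ : ζ.re < 0) (y : ℝ) :
    exp w * mbFactor (ζ - 1) w y = -((ζ + I * y) * mbFactor ζ w y) := by
  have hne : -ζ - I * y ≠ 0 := fun h => by
    have := congrArg re h
    simp at this; linarith
  have hG : Gamma (-(ζ - 1) - I * y) = (-ζ - I * y) * Gamma (-ζ - I * y) := by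
    rw [← Gamma_add_one _ hne]; congr 1; ring
  have hexp : exp w * exp ((ζ - 1 + I * y) * w) = exp ((ζ + I * y) * w) := by
    rw [← exp_add]; congr 1; ring
  unfold mbFactor
  rw [hG, mul_left_comm, hexp]
  ring

lemma hasDerivAt_mbFactor {ζ w : ℂ} (hζ : ζ.re < 0) (y : ℝ) :
    HasDerivAt (fun w => mbFactor ζ w y) (-(exp w * mbFactor (ζ - 1) w y)) w := by
  refine ((((hasDerivAt_id w).const_mul (ζ + I * y)).cexp).const_mul
    (Gamma (-ζ - I * y))).congr_deriv ?_
  rw [exp_mul_mbFactor_sub_one hζ, neg_neg]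
  unfold mbFactor
  simp only [id]
  ring

lemma differentiableAt_mbFactor_left {ζ w : ℂ} (hζ : ζ.re < 0) (y : ℝ) :
    DifferentiableAt ℂ (fun ζ => mbFactor ζ w y) ζ := by
  refine DifferentiableAt.mul ?_ (by fun_prop)
  exact DifferentiableAt.comp ζ (f := fun ζ : ℂ => -ζ - I * y) (g := Gamma)
    (differentiableAt_Gamma_of_re_pos (by simpa using hζ)) (by fun_prop)

/-- Half of ε pays for replacing ζ by γ inside Γ, the other half for moving w within the ball. The
same γ serves every ζ in Q. -/
lemma exists_norm_mbFactor_le {Q : Set ℂ} (hQ : IsCompact Q) (hneg : ∀ ζ ∈ Q, ζ.re < 0)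
    {γ ε : ℝ} (hγ : γ < 0) (hε : 0 < ε) (w₀ : ℂ) :
    ∃ C, 0 ≤ C ∧ ∀ ζ ∈ Q, ∀ w ∈ Metric.closedBall w₀ (ε / 2), ∀ y : ℝ,
      ‖mbFactor ζ w y‖ ≤ C * mbMajorant γ w₀.im ε y := by
  obtain ⟨C, hC0, hC⟩ := exists_norm_Gamma_sub_le (Q := Neg.neg '' Q) (hQ.image continuous_neg)
    (by rintro _ ⟨ζ, hζ, rfl⟩; simpa using hneg ζ hζ) (c := -γ) (ε := ε / 2) (by linarith)
    (by linarith)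
  obtain ⟨R, hR⟩ := hQ.isBounded.exists_norm_le
  refine ⟨C * Real.exp (|R| * (‖w₀‖ + ε / 2)), by positivity, fun ζ hζ w hw y => ?_⟩
  rw [mem_closedBall_iff_norm] at hw
  have hre : (ζ * w).re ≤ |R| * (‖w₀‖ + ε / 2) := by
    refine (re_le_norm _).trans ?_
    rw [norm_mul]
    refine mul_le_mul ((hR ζ hζ).trans (le_abs_self R)) ?_ (norm_nonneg _) (abs_nonneg _)
    calc ‖w‖ = ‖w₀ + (w - w₀)‖ := by congr 1; ring
      _ ≤ ‖w₀‖ + ‖w - w₀‖ := norm_add_le _ _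
      _ ≤ _ := by linarith
  have him : -(y * w.im) ≤ -(y * w₀.im) + ε / 2 * |y| := by
    have h1 : |w.im - w₀.im| ≤ ε / 2 := by
      have := (abs_im_le_norm (w - w₀)).trans hw
      simpa using this
    have h2 : -(y * (w.im - w₀.im)) ≤ |y| * (ε / 2) := by
      refine (neg_le_abs _).trans ?_
      rw [abs_mul]
      gcongr
    linarith
  have hexp : ‖exp ((ζ + I * y) * w)‖ ≤
      Real.exp (|R| * (‖w₀‖ + ε / 2)) * Real.exp (-(y * w₀.im) + ε / 2 * |y|) := by
    rw [norm_exp, ← Real.exp_add, Real.exp_le_exp]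
    have : ((ζ + I * y) * w).re = (ζ * w).re + -(y * w.im) := by
      simp; ring
    rw [this]
    exact add_le_add hre him
  have hG := hC (-ζ) ⟨ζ, hζ, rfl⟩ y
  have he : Real.exp (ε / 2 * |y|) * Real.exp (-(y * w₀.im) + ε / 2 * |y|) =
      Real.exp (-(y * w₀.im) + ε * |y|) := by
    rw [← Real.exp_add]; congr 1; ring
  unfold mbFactor mbMajorant
  rw [norm_mul, ← he]
  calc _ ≤ _ := mul_le_mul hG hexp (norm_nonneg _) (by positivity)
    _ = _ := by ring

/-- The real linear form `b_j · τ`. -/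
noncomputable def realDot {d N : ℕ} (B : Matrix (Fin d) (Fin N) ℤ) (τ : Fin d → ℝ) (j : Fin N) :
    ℝ :=
  ∑ k, (B k j : ℝ) * τ k

/-- The Mellin–Barnes integrand along `√-1 ℝ^d` for complex exponents `ζ`. -/
noncomputable def mbProd {d N : ℕ} (B : Matrix (Fin d) (Fin N) ℤ) (ζ w : Fin N → ℂ)
    (τ : Fin d → ℝ) : ℂ :=
  ∏ j, mbFactor (ζ j) (w j) (realDot B τ j)

/-- The Mellin–Barnes integral for complex exponents `ζ`, without the factor `√-1 ^ d`. -/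
noncomputable def mbInt {d N : ℕ} (B : Matrix (Fin d) (Fin N) ℤ) (ζ w : Fin N → ℂ) : ℂ :=
  ∫ τ : Fin d → ℝ, mbProd B ζ w τ

/-- The product of the majorants of the Mellin–Barnes factors. -/
noncomputable def majorantProd {d N : ℕ} (B : Matrix (Fin d) (Fin N) ℤ) (γ : Fin N → ℝ)
    (w : Fin N → ℂ) (ε : ℝ) (τ : Fin d → ℝ) : ℝ :=
  ∏ j, mbMajorant (γ j) (w j).im ε (realDot B τ j)

/-! ### Domination and differentiation under the integral. -/

section Integral

variable {d N : ℕ} {B : Matrix (Fin d) (Fin N) ℤ}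

lemma continuous_realDot (B : Matrix (Fin d) (Fin N) ℤ) (j : Fin N) :
    Continuous fun τ => realDot B τ j := by
  unfold realDot; fun_prop

lemma continuous_mbProd {ζ w : Fin N → ℂ} (hζ : ∀ j, (ζ j).re < 0) :
    Continuous (mbProd B ζ w) :=
  continuous_finsetProd _ fun j _ => (continuous_mbFactor (hζ j)).comp (continuous_realDot B j)

lemma majorantProd_nonneg (B : Matrix (Fin d) (Fin N) ℤ) (γ : Fin N → ℝ) (w : Fin N → ℂ) (ε : ℝ)
    (τ : Fin d → ℝ) : 0 ≤ majorantProd B γ w ε τ :=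
  Finset.prod_nonneg fun _ _ => mbMajorant_nonneg _ _ _ _

lemma exists_norm_mbProd_le (B : Matrix (Fin d) (Fin N) ℤ) {Q : Fin N → Set ℂ}
    (hQ : ∀ j, IsCompact (Q j))
    (hneg : ∀ j, ∀ ζ ∈ Q j, ζ.re < 0) {γ : Fin N → ℝ} (hγ : ∀ j, γ j < 0) {ε : ℝ} (hε : 0 < ε)
    (w₀ : Fin N → ℂ) :
    ∃ C, 0 ≤ C ∧ ∀ ζ : Fin N → ℂ, (∀ j, ζ j ∈ Q j) → ∀ w ∈ Metric.closedBall w₀ (ε / 2),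
      ∀ τ : Fin d → ℝ, ‖mbProd B ζ w τ‖ ≤ C * majorantProd B γ w₀ ε τ := by
  choose C hC0 hC using fun j => exists_norm_mbFactor_le (hQ j) (hneg j) (hγ j) hε (w₀ j)
  refine ⟨∏ j, C j, Finset.prod_nonneg fun j _ => hC0 j, fun ζ hζ w hw τ => ?_⟩
  rw [mbProd, norm_prod, majorantProd, ← Finset.prod_mul_distrib]
  refine Finset.prod_le_prod (fun _ _ => norm_nonneg _) fun j _ => hC j _ (hζ j) _ ?_ _
  exact (closedBall_pi w₀ (by positivity : 0 ≤ ε / 2) ▸ hw) j (Set.mem_univ j)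

/-- Exponential domination of the Mellin–Barnes integrand near the point with logarithms `w`. -/
def IsDominated (B : Matrix (Fin d) (Fin N) ℤ) (γ : Fin N → ℝ) (w : Fin N → ℂ) : Prop :=
  ∃ ε, 0 < ε ∧ Integrable (majorantProd B γ w ε)

/-- Domination at γ yields convergence for every exponent of negative real part, in particular for
those produced by derivatives and contour shifts. -/
lemma IsDominated.integrable {γ : Fin N → ℝ} (hγ : ∀ j, γ j < 0) {w : Fin N → ℂ}
    (h : IsDominated B γ w) {ζ : Fin N → ℂ} (hζ : ∀ j, (ζ j).re < 0) :
    Integrable (mbProd B ζ w) := by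
  obtain ⟨ε, hε, hint⟩ := h
  obtain ⟨C, -, hC⟩ := exists_norm_mbProd_le B (Q := fun j => {ζ j}) (fun _ => isCompact_singleton)
    (by simpa using hζ) hγ hε w
  refine (hint.const_mul C).mono' (continuous_mbProd hζ).aestronglyMeasurable
    (Eventually.of_forall fun τ => hC ζ (fun _ => rfl) w ?_ τ)
  exact Metric.mem_closedBall_self (by positivity)

lemma re_sub_single_neg {ζ : Fin N → ℂ} (hζ : ∀ j, (ζ j).re < 0) (i j : Fin N) :
    ((ζ - Pi.single i (1 : ℂ) : Fin N → ℂ) j).re < 0 := by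
  rcases eq_or_ne j i with rfl | h
  · have := hζ j
    simp; linarith
  · simpa [h] using hζ j

lemma prod_erase_mul_mbFactor (ζ w : Fin N → ℂ) (τ : Fin d → ℝ) (i : Fin N) :
    (∏ j ∈ Finset.univ.erase i, mbFactor (ζ j) (w j) (realDot B τ j)) *
      mbFactor (ζ i - 1) (w i) (realDot B τ i) = mbProd B (ζ - Pi.single i (1 : ℂ)) w τ := by
  rw [mbProd, ← Finset.prod_erase_mul _ _ (Finset.mem_univ i)]
  congr 1
  · refine Finset.prod_congr rfl fun j hj => ?_
    simp [Finset.ne_of_mem_erase hj]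
  · simp

lemma exp_mul_mbProd_sub_single {ζ w : Fin N → ℂ} (hζ : ∀ j, (ζ j).re < 0) (τ : Fin d → ℝ)
    (i : Fin N) :
    exp (w i) * mbProd B (ζ - Pi.single i (1 : ℂ)) w τ =
      -((ζ i + I * realDot B τ i) * mbProd B ζ w τ) := by
  rw [← prod_erase_mul_mbFactor, mul_left_comm, exp_mul_mbFactor_sub_one (hζ i), mbProd,
    ← Finset.prod_erase_mul _ _ (Finset.mem_univ i)]
  ring

/-- The derivative of the Mellin–Barnes integrand with respect to the logarithms. -/
noncomputable def mbProdDeriv (B : Matrix (Fin d) (Fin N) ℤ) (ζ w : Fin N → ℂ) (τ : Fin d → ℝ) :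
    (Fin N → ℂ) →L[ℂ] ℂ :=
  -∑ j, (exp (w j) * mbProd B (ζ - Pi.single j (1 : ℂ)) w τ) •
    (ContinuousLinearMap.proj j : (Fin N → ℂ) →L[ℂ] ℂ)

lemma hasFDerivAt_mbProd {ζ w : Fin N → ℂ} (hζ : ∀ j, (ζ j).re < 0) (τ : Fin d → ℝ) :
    HasFDerivAt (fun w => mbProd B ζ w τ) (mbProdDeriv B ζ w τ) w := by
  have hj : ∀ j, HasFDerivAt (fun w : Fin N → ℂ => mbFactor (ζ j) (w j) (realDot B τ j))
      (-(exp (w j) * mbFactor (ζ j - 1) (w j) (realDot B τ j)) •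
        (ContinuousLinearMap.proj j : (Fin N → ℂ) →L[ℂ] ℂ)) w := fun j =>
    HasDerivAt.comp_hasFDerivAt (h₂ := fun z => mbFactor (ζ j) z (realDot B τ j))
      (f := fun w : Fin N → ℂ => w j) w (hasDerivAt_mbFactor (hζ j) (realDot B τ j))
      (ContinuousLinearMap.proj j : (Fin N → ℂ) →L[ℂ] ℂ).hasFDerivAt
  have h := HasFDerivAt.finsetProd (u := Finset.univ) fun j _ => hj j
  refine h.congr_fderiv ?_
  ext x
  simp only [mbProdDeriv, neg_apply, sum_apply, smul_apply, ContinuousLinearMap.proj_apply,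
    smul_eq_mul, ← prod_erase_mul_mbFactor, ← Finset.sum_neg_distrib]
  exact Finset.sum_congr rfl fun j _ => by ring

theorem hasFDerivAt_mbInt {γ : Fin N → ℝ} (hγ : ∀ j, γ j < 0) {w₀ : Fin N → ℂ}
    (h : IsDominated B γ w₀) {ζ : Fin N → ℂ} (hζ : ∀ j, (ζ j).re < 0) :
    HasFDerivAt (mbInt B ζ)
      (-∑ j, (exp (w₀ j) * mbInt B (ζ - Pi.single j (1 : ℂ)) w₀) •
        (ContinuousLinearMap.proj j : (Fin N → ℂ) →L[ℂ] ℂ)) w₀ := by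
  have hζ' := fun i => re_sub_single_neg hζ i
  have hint := fun i => (h.integrable hγ (hζ' i)).const_mul (exp (w₀ i))
  have hint0 := h.integrable hγ hζ
  obtain ⟨ε, hε, hmaj⟩ := h
  choose C hC0 hC using fun i => exists_norm_mbProd_le B
    (Q := fun j => {(ζ - Pi.single i (1 : ℂ) : Fin N → ℂ) j}) (fun _ => isCompact_singleton)
    (by simpa using hζ' i) hγ hε w₀
  have hdiff : ∀ τ : Fin d → ℝ, ∀ w ∈ Metric.ball w₀ (ε / 2),
      HasFDerivAt (fun w => mbProd B ζ w τ) (mbProdDeriv B ζ w τ) w :=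
    fun τ w _ => hasFDerivAt_mbProd hζ τ
  have hmeas : AEStronglyMeasurable (mbProdDeriv B ζ w₀) := by
    refine Continuous.aestronglyMeasurable (continuous_finsetSum _ fun j _ => ?_).neg
    exact ((continuous_mbProd (hζ' j)).const_mul _).smul continuous_const
  have hbound : ∀ τ : Fin d → ℝ, ∀ w ∈ Metric.ball w₀ (ε / 2), ‖mbProdDeriv B ζ w τ‖ ≤
      (∑ j, Real.exp (‖w₀‖ + ε / 2) * C j *
        ‖(ContinuousLinearMap.proj j : (Fin N → ℂ) →L[ℂ] ℂ)‖) * majorantProd B γ w₀ ε τ := by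
    intro τ w hw
    rw [mbProdDeriv, norm_neg, Finset.sum_mul]
    refine (norm_sum_le _ _).trans (Finset.sum_le_sum fun j _ => ?_)
    have hw' : ‖w - w₀‖ ≤ ε / 2 := (mem_ball_iff_norm.1 hw).le
    have hexp : ‖exp (w j)‖ ≤ Real.exp (‖w₀‖ + ε / 2) := by
      rw [norm_exp, Real.exp_le_exp]
      calc (w j).re ≤ ‖w j‖ := re_le_norm _
        _ ≤ ‖w‖ := norm_le_pi_norm w j
        _ = ‖w₀ + (w - w₀)‖ := by congr 1; abel
        _ ≤ _ := (norm_add_le _ _).trans (by linarith)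
    have hP := hC j _ (fun _ => rfl) w (Metric.ball_subset_closedBall hw) τ
    rw [norm_smul, norm_mul]
    calc _ ≤ (Real.exp (‖w₀‖ + ε / 2) * (C j * majorantProd B γ w₀ ε τ)) *
          ‖(ContinuousLinearMap.proj j : (Fin N → ℂ) →L[ℂ] ℂ)‖ := by gcongr
      _ = _ := by ring
  have key := hasFDerivAt_integral_of_dominated_of_fderiv_le (F := fun w τ => mbProd B ζ w τ)
    (Metric.ball_mem_nhds w₀ (half_pos hε))
    (Eventually.of_forall fun w => (continuous_mbProd hζ).aestronglyMeasurable) hint0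
    hmeas (Eventually.of_forall hbound) (hmaj.const_mul _) (Eventually.of_forall hdiff)
  refine key.congr_fderiv ?_
  simp only [mbProdDeriv]
  rw [integral_neg, integral_finsetSum _ fun j _ => (hint j).smul_const _]
  congr 1
  refine Finset.sum_congr rfl fun j _ => ?_
  rw [integral_smul_const, integral_const_mul, mbInt]

/-! ### Shifting the contour. -/

lemma mbFactor_add_mul_I (ζ w : ℂ) (y t : ℝ) :
    mbFactor (ζ + t * I) w y = mbFactor ζ w (y + t) := by
  unfold mbFactor
  push_cast
  congr 2 <;> ring

lemma realDot_add_smul (B : Matrix (Fin d) (Fin N) ℤ) (τ m : Fin d → ℝ) (t : ℝ) (j : Fin N) :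
    realDot B (τ + t • m) j = realDot B τ j + t * realDot B m j := by
  simp only [realDot, Pi.add_apply, Pi.smul_apply, smul_eq_mul, Finset.mul_sum,
    ← Finset.sum_add_distrib]
  exact Finset.sum_congr rfl fun k _ => by ring

/-- The exponents `c + z l` along the line in direction `l = (b_1 · m, …, b_N · m)`. -/
noncomputable def shiftExponent (B : Matrix (Fin d) (Fin N) ℤ) (c : Fin N → ℝ) (m : Fin d → ℝ)
    (z : ℂ) : Fin N → ℂ :=
  fun j => c j + z * realDot B m j

lemma shiftExponent_re (c : Fin N → ℝ) (m : Fin d → ℝ) (z : ℂ) (j : Fin N) :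
    (shiftExponent B c m z j).re = c j + z.re * realDot B m j := by
  simp [shiftExponent]

/-- The points to which the contour can be shifted in the complex direction `m` without meeting a
pole of the integrand. -/
def shiftDomain (B : Matrix (Fin d) (Fin N) ℤ) (c : Fin N → ℝ) (m : Fin d → ℝ) : Set ℂ :=
  {z | ∀ j, (shiftExponent B c m z j).re < 0}

lemma continuous_shiftExponent (c : Fin N → ℝ) (m : Fin d → ℝ) (j : Fin N) :
    Continuous fun z => shiftExponent B c m z j := by
  unfold shiftExponent; fun_prop

lemma isOpen_shiftDomain (c : Fin N → ℝ) (m : Fin d → ℝ) : IsOpen (shiftDomain B c m) := by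
  simp only [shiftDomain, Set.ofPred_forall]
  exact isOpen_iInter_of_finite fun j =>
    isOpen_lt (continuous_re.comp (continuous_shiftExponent c m j)) continuous_const

lemma convex_shiftDomain (c : Fin N → ℝ) (m : Fin d → ℝ) : Convex ℝ (shiftDomain B c m) := by
  intro x hx y hy a b ha hb hab j
  have hx := hx j
  have hy := hy j
  rw [shiftExponent_re] at *
  have : c j + (a • x + b • y).re * realDot B m j =
      a * (c j + x.re * realDot B m j) + b * (c j + y.re * realDot B m j) := by
    simp only [add_re, real_smul, re_ofReal_mul]
    linear_combination -c j * hab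
  rw [this]
  rcases ha.eq_or_lt with rfl | ha'
  · have : b = 1 := by linarith
    subst this; linarith
  · nlinarith [mul_neg_of_pos_of_neg ha' hx, mul_nonneg hb (neg_nonneg.2 hy.le)]

/-- An imaginary shift of the exponents is the real translation τ ↦ τ + t m, under which Lebesgue
measure is invariant. -/
lemma mbInt_shiftExponent_add_mul_I (c : Fin N → ℝ) (m : Fin d → ℝ) (w : Fin N → ℂ) (z : ℂ)
    (t : ℝ) :
    mbInt B (shiftExponent B c m (z + t * I)) w = mbInt B (shiftExponent B c m z) w := by
  have h : mbProd B (shiftExponent B c m (z + t * I)) w =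
      fun τ => mbProd B (shiftExponent B c m z) w (τ + t • m) := by
    funext τ
    refine Finset.prod_congr rfl fun j _ => ?_
    rw [realDot_add_smul, ← mbFactor_add_mul_I]
    congr 1
    simp only [shiftExponent]
    push_cast
    ring
  rw [mbInt, h, integral_add_right_eq_self (mbProd B (shiftExponent B c m z) w) (t • m), mbInt]

lemma differentiableAt_mbInt_shiftExponent {γ : Fin N → ℝ} (hγ : ∀ j, γ j < 0) {w : Fin N → ℂ}
    (h : IsDominated B γ w) {c : Fin N → ℝ} {m : Fin d → ℝ} {z₀ : ℂ}
    (hz₀ : z₀ ∈ shiftDomain B c m) :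
    DifferentiableAt ℂ (fun z => mbInt B (shiftExponent B c m z) w) z₀ := by
  have hint := fun z (hz : z ∈ shiftDomain B c m) =>
    h.integrable hγ (ζ := shiftExponent B c m z) hz
  obtain ⟨ε, hε, hmaj⟩ := h
  obtain ⟨R, hR, hsub⟩ := Metric.nhds_basis_closedBall.mem_iff.1
    ((isOpen_shiftDomain (B := B) c m).mem_nhds hz₀)
  obtain ⟨C, hC0, hC⟩ := exists_norm_mbProd_le B
    (Q := fun j => (fun z => shiftExponent B c m z j) '' Metric.closedBall z₀ R)
    (fun j => (isCompact_closedBall z₀ R).image (continuous_shiftExponent c m j))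
    (by rintro j _ ⟨z, hz, rfl⟩; exact hsub hz j) hγ hε w
  have hle : ∀ τ : Fin d → ℝ, ∀ z ∈ Metric.closedBall z₀ R,
      ‖mbProd B (shiftExponent B c m z) w τ‖ ≤ C * majorantProd B γ w ε τ := fun τ z hz =>
    hC _ (fun j => ⟨z, hz, rfl⟩) w (Metric.mem_closedBall_self (by positivity)) τ
  have hdiff : ∀ τ : Fin d → ℝ, ∀ z ∈ Metric.closedBall z₀ R,
      DifferentiableAt ℂ (fun z => mbProd B (shiftExponent B c m z) w τ) z := fun τ z hz => by
    refine DifferentiableAt.fun_finsetProd fun j _ => ?_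
    exact DifferentiableAt.comp z (f := fun z => shiftExponent B c m z j)
      (g := fun ζ => mbFactor ζ (w j) (realDot B τ j))
      (differentiableAt_mbFactor_left (hsub hz j) _) (by unfold shiftExponent; fun_prop)
  have hball : ∀ z ∈ Metric.ball z₀ (R / 2), Metric.closedBall z (R / 2) ⊆ Metric.closedBall z₀ R :=
    fun z hz => Metric.closedBall_subset_closedBall' (by
      have := (Metric.mem_ball.1 hz).le
      linarith)
  -- Cauchy's estimate on circles of radius R/2, which stay in the closed ball of radius R.
  have hbound : ∀ τ : Fin d → ℝ, ∀ z ∈ Metric.ball z₀ (R / 2),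
      ‖deriv (fun z => mbProd B (shiftExponent B c m z) w τ) z‖ ≤
        C / (R / 2) * majorantProd B γ w ε τ := fun τ z hz => by
    rw [div_mul_eq_mul_div]
    refine norm_deriv_le_of_forall_mem_sphere_norm_le (half_pos hR) ?_
      fun x hx => hle τ x (hball z hz (Metric.sphere_subset_closedBall hx))
    refine DifferentiableOn.diffContOnCl_ball (U := Metric.closedBall z₀ R) ?_ (hball z hz)
    exact fun x hx => (hdiff τ x hx).differentiableWithinAt
  -- The derivative at z₀ is the pointwise limit in τ of difference quotients along z₀ + R/(2(n+1)),
  -- each continuous in τ.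
  have hmeas : AEStronglyMeasurable
      (fun τ => deriv (fun z => mbProd B (shiftExponent B c m z) w τ) z₀) := by
    have hseq : Tendsto (fun n : ℕ => z₀ + (R / 2 * (1 / ((n : ℝ) + 1)) : ℝ)) atTop (𝓝[≠] z₀) := by
      refine tendsto_nhdsWithin_iff.2 ⟨?_, Eventually.of_forall fun n => ?_⟩
      · have := (tendsto_one_div_add_atTop_nhds_zero_nat (𝕜 := ℝ)).const_mul (R / 2)
        have := (continuous_ofReal.tendsto _).comp this
        simpa using this.const_add z₀
      · have : (R / 2 * (1 / ((n : ℝ) + 1)) : ℝ) ≠ 0 := by positivity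
        simpa only [Set.mem_compl_iff, Set.mem_singleton_iff, add_eq_left, ofReal_eq_zero] using this
    have hmem : ∀ n : ℕ, z₀ + (R / 2 * (1 / ((n : ℝ) + 1)) : ℝ) ∈ shiftDomain B c m := fun n => by
      refine hsub ?_
      rw [mem_closedBall_iff_norm, add_sub_cancel_left, norm_real, Real.norm_of_nonneg (by positivity)]
      have : 1 / ((n : ℝ) + 1) ≤ 1 := by
        rw [div_le_one (by positivity)]
        linarith [n.cast_nonneg (α := ℝ)]
      nlinarith
    refine aestronglyMeasurable_of_tendsto_ae atTop
      (f := fun (n : ℕ) (τ : Fin d → ℝ) => slope (fun z => mbProd B (shiftExponent B c m z) w τ) z₀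
        (z₀ + (R / 2 * (1 / ((n : ℝ) + 1)) : ℝ))) (fun n => ?_) (Eventually.of_forall fun τ => ?_)
    · simp only [slope_def_module]
      have hcont : Continuous fun τ : Fin d → ℝ =>
          (mbProd B (shiftExponent B c m (z₀ + (R / 2 * (1 / ((n : ℝ) + 1)) : ℝ))) w τ -
            mbProd B (shiftExponent B c m z₀) w τ) :=
        (continuous_mbProd (hmem n)).sub (continuous_mbProd hz₀)
      exact hcont.aestronglyMeasurable.const_smul
        ((z₀ + (R / 2 * (1 / ((n : ℝ) + 1)) : ℝ) - z₀)⁻¹)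
    · exact (hasDerivAt_iff_tendsto_slope.1
        (hdiff τ z₀ (Metric.mem_closedBall_self hR.le)).hasDerivAt).comp hseq
  exact (hasDerivAt_integral_of_dominated_loc_of_deriv_le
    (F := fun z τ => mbProd B (shiftExponent B c m z) w τ)
    (Metric.ball_mem_nhds z₀ (half_pos hR))
    ((isOpen_shiftDomain (B := B) c m).mem_nhds hz₀ |> fun hU => by
      filter_upwards [hU] with z hz
      exact (continuous_mbProd hz).aestronglyMeasurable)
    (hint z₀ hz₀) hmeas (Eventually.of_forall hbound) (hmaj.const_mul _)
    (Eventually.of_forall fun τ z hz => (hdiff τ z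
      (Metric.ball_subset_closedBall.trans (Metric.closedBall_subset_closedBall (by linarith))
        hz)).hasDerivAt)).2.differentiableAt

/-- A holomorphic function that is constant in the imaginary direction has zero derivative; this
replaces estimates on the sides of a contour. -/
lemma deriv_mbInt_shiftExponent {γ : Fin N → ℝ} (hγ : ∀ j, γ j < 0) {w : Fin N → ℂ}
    (h : IsDominated B γ w) {c : Fin N → ℝ} {m : Fin d → ℝ} {z : ℂ}
    (hz : z ∈ shiftDomain B c m) :
    deriv (fun z => mbInt B (shiftExponent B c m z) w) z = 0 := by
  have h1 := (differentiableAt_mbInt_shiftExponent hγ h hz).hasDerivAt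
  set φ := fun z => mbInt B (shiftExponent B c m z) w with hφ
  have h2 : HasDerivAt (fun t : ℝ => z + t * I) I 0 := by
    simpa using ((hasDerivAt_id (0 : ℝ)).ofReal_comp.mul_const I).const_add z
  have h3 : HasDerivAt (fun t : ℝ => φ (z + t * I)) (deriv φ z * I) 0 :=
    HasDerivAt.comp (h₂ := φ) (h := fun t : ℝ => z + t * I) 0 (by simpa using h1) h2
  have h4 : HasDerivAt (fun t : ℝ => φ (z + t * I)) 0 0 := by
    simp only [hφ, mbInt_shiftExponent_add_mul_I]
    exact hasDerivAt_const _ _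
  simpa using h3.unique h4

/-- Shift of the contour by `m`: the integral is unchanged if no pole is met. -/
theorem mbInt_add_realDot {γ : Fin N → ℝ} (hγ : ∀ j, γ j < 0) {w : Fin N → ℂ}
    (h : IsDominated B γ w) {c : Fin N → ℝ} (hc : ∀ j, c j < 0) {m : Fin d → ℝ}
    (hcm : ∀ j, c j + realDot B m j < 0) :
    mbInt B (fun j => ((c j + realDot B m j : ℝ) : ℂ)) w = mbInt B (fun j => (c j : ℂ)) w := by
  have h0 : (0 : ℂ) ∈ shiftDomain B c m := fun j => by simpa [shiftExponent_re] using hc j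
  have h1 : (1 : ℂ) ∈ shiftDomain B c m := fun j => by simpa [shiftExponent_re] using hcm j
  have key := (isOpen_shiftDomain (B := B) c m).is_const_of_deriv_eq_zero
    (convex_shiftDomain c m).isPreconnected
    (f := fun z => mbInt B (shiftExponent B c m z) w)
    (fun z hz => (differentiableAt_mbInt_shiftExponent hγ h hz).differentiableWithinAt)
    (fun z hz => deriv_mbInt_shiftExponent hγ h hz) h1 h0
  have e1 : shiftExponent B c m 1 = fun j => ((c j + realDot B m j : ℝ) : ℂ) := by
    funext j; simp [shiftExponent]
  have e0 : shiftExponent B c m 0 = fun j => (c j : ℂ) := by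
    funext j; simp [shiftExponent]
  rwa [e1, e0] at key

/-! ### From absolute convergence to domination. -/

lemma colDot_imagPoint (B : Matrix (Fin d) (Fin N) ℤ) (τ : Fin d → ℝ) (j : Fin N) :
    colDot B j (imagPoint τ) = I * realDot B τ j := by
  simp only [colDot, imagPoint, realDot, ofReal_sum, Finset.mul_sum]
  refine Finset.sum_congr rfl fun k _ => ?_
  push_cast
  ring

lemma mbIntegrand_imagPoint (B : Matrix (Fin d) (Fin N) ℤ) (γ : Fin N → ℝ) (w : Fin N → ℂ)
    (τ : Fin d → ℝ) :
    mbIntegrand B γ w (imagPoint τ) = mbProd B (fun j => (γ j : ℂ)) w τ := by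
  simp only [mbIntegrand, colDot_imagPoint, mbProd, mbFactor]

lemma mbIntegral_eq (B : Matrix (Fin d) (Fin N) ℤ) (γ : Fin N → ℝ) (w : Fin N → ℂ) :
    mbIntegral B γ w = I ^ d * mbInt B (fun j => (γ j : ℂ)) w := by
  simp only [mbIntegral, mbIntegrand_imagPoint, mbInt]

lemma continuous_mbMajorant {γ : ℝ} (hγ : γ < 0) (θ ε : ℝ) : Continuous (mbMajorant γ θ ε) := by
  refine Continuous.mul (Continuous.norm (continuous_iff_continuousAt.2 fun y => ?_))
    (by fun_prop)
  exact ContinuousAt.comp (f := fun y : ℝ => ((-γ : ℝ) : ℂ) - I * y) (g := Gamma)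
    (differentiableAt_Gamma_of_re_pos (by simpa using hγ)).continuousAt (by fun_prop)

/-- The sign attached to a Boolean. -/
def boolSign (b : Bool) : ℝ := if b then 1 else -1

/-- exp(ε|y|) ≤ exp(εy) + exp(-εy), and each term amounts to moving Im w by ∓ε. -/
lemma mbMajorant_le (γ : ℝ) (w : ℂ) (ε y : ℝ) :
    mbMajorant γ w.im ε y ≤
      Real.exp (-(γ * w.re)) * ∑ b, ‖mbFactor γ (w + (ε * boolSign b : ℝ) * I) y‖ := by
  have h : ∀ b, ‖mbFactor γ (w + (ε * boolSign b : ℝ) * I) y‖ =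
      ‖Gamma ((-γ : ℝ) - I * y)‖ * (Real.exp (γ * w.re) *
        Real.exp (-(y * w.im) - ε * boolSign b * y)) := fun b => by
    rw [mbFactor, norm_mul, norm_exp, ← Real.exp_add]
    congr 2
    · push_cast; rfl
    · simp; ring
  simp only [h, ← Finset.mul_sum]
  have hcancel : Real.exp (-(γ * w.re)) * Real.exp (γ * w.re) = 1 := by
    rw [← Real.exp_add]; simp
  have hle : Real.exp (-(y * w.im) + ε * |y|) ≤
      ∑ b, Real.exp (-(y * w.im) - ε * boolSign b * y) := by
    simp only [Fintype.sum_bool, boolSign, if_true, Bool.false_eq_true, if_false]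
    rcases abs_cases y with ⟨hy, -⟩ | ⟨hy, -⟩ <;> rw [hy]
    · refine le_add_of_nonneg_of_le (Real.exp_pos _).le (le_of_eq ?_)
      congr 1; ring
    · refine le_add_of_le_of_nonneg (le_of_eq ?_) (Real.exp_pos _).le
      congr 1; ring
  calc mbMajorant γ w.im ε y ≤ ‖Gamma ((-γ : ℝ) - I * y)‖ *
        ∑ b, Real.exp (-(y * w.im) - ε * boolSign b * y) := by
        unfold mbMajorant; gcongr
    _ = (Real.exp (-(γ * w.re)) * Real.exp (γ * w.re)) * (‖Gamma ((-γ : ℝ) - I * y)‖ *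
        ∑ b, Real.exp (-(y * w.im) - ε * boolSign b * y)) := by rw [hcancel, one_mul]
    _ = _ := by ring

/-- If the Mellin–Barnes integral converges absolutely near `w`, it is exponentially dominated. -/
lemma isDominated_of_eventually {γ : Fin N → ℝ} (hγ : ∀ j, γ j < 0) {w : Fin N → ℂ}
    (h : ∀ᶠ u in 𝓝 w, MBConverges B γ u) : IsDominated B γ w := by
  obtain ⟨δ, hδ, hball⟩ := Metric.eventually_nhds_iff_ball.1 h
  refine ⟨δ / 2, half_pos hδ, ?_⟩
  -- Expanding the product over j of the two-term bounds gives one convergent integral for each of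
  -- the 2^N sign vectors.
  set u : (Fin N → Bool) → Fin N → ℂ := fun σ j => w j + (δ / 2 * boolSign (σ j) : ℝ) * I with hu
  have hmem : ∀ σ, u σ ∈ Metric.ball w δ := fun σ => by
    rw [mem_ball_iff_norm]
    refine lt_of_le_of_lt ((pi_norm_le_iff_of_nonneg (half_pos hδ).le).2 fun j => ?_)
      (half_lt_self hδ)
    simp only [hu, Pi.sub_apply, add_sub_cancel_left, norm_mul, norm_I, mul_one, norm_real,
      Real.norm_eq_abs]
    cases σ j <;> simp [boolSign, abs_of_pos (half_pos hδ)]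
  have hint : ∀ σ, Integrable (mbProd B (fun j => (γ j : ℂ)) (u σ)) := fun σ => by
    simpa only [MBConverges, mbIntegrand_imagPoint] using hball _ (hmem σ)
  refine ((integrable_finsetSum Finset.univ fun σ _ => (hint σ).norm).const_mul
    (∏ j, Real.exp (-(γ j * (w j).re)))).mono' ?_ (Eventually.of_forall fun τ => ?_)
  · exact (continuous_finsetProd _ fun j _ => (continuous_mbMajorant (hγ j) _ _).comp
      (continuous_realDot B j)).aestronglyMeasurable
  · rw [Real.norm_of_nonneg (majorantProd_nonneg _ _ _ _ _)]
    calc majorantProd B γ w (δ / 2) τ ≤ ∏ j, (Real.exp (-(γ j * (w j).re)) *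
          ∑ b, ‖mbFactor (γ j) (w j + (δ / 2 * boolSign b : ℝ) * I) (realDot B τ j)‖) :=
          Finset.prod_le_prod (fun j _ => mbMajorant_nonneg _ _ _ _) fun j _ => mbMajorant_le _ _ _ _
      _ = _ := by
          rw [Finset.prod_mul_distrib, Finset.prod_univ_sum, Fintype.piFinset_univ]
          simp only [mbProd, norm_prod, hu]

/-! ### Passing from the logarithms to v. -/

section LogBranch

variable {U : Set (Fin N → ℂ)} {logv : (Fin N → ℂ) → Fin N → ℂ}

/-- The two logarithms of exp w_j differ by an element of 2πiℤ, and by continuity by less than 1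
near `logv v`, hence by 0. So the values of `logv` on U fill a neighbourhood of `logv v`. -/
lemma IsLogBranch.eventually_leftInverse (hlog : IsLogBranch U logv) (hU : IsOpen U)
    {v : Fin N → ℂ} (hv : v ∈ U) :
    ∀ᶠ w in 𝓝 (logv v), (fun j => exp (w j)) ∈ U ∧ logv (fun j => exp (w j)) = w := by
  have hE : Continuous fun (w : Fin N → ℂ) j => exp (w j) := by fun_prop
  have hEv : (fun j => exp (logv v j)) = v := funext fun j => hlog.exp_eq v hv j
  have hEt : Tendsto (fun (w : Fin N → ℂ) j => exp (w j)) (𝓝 (logv v)) (𝓝 v) := by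
    simpa only [hEv] using hE.tendsto (logv v)
  have hL : Tendsto (fun w : Fin N → ℂ => logv (fun j => exp (w j)) - w) (𝓝 (logv v)) (𝓝 0) := by
    have h1 := ((hlog.continuousOn.continuousAt (hU.mem_nhds hv)).tendsto.comp hEt).sub
      (tendsto_id (α := Fin N → ℂ))
    simpa using h1
  filter_upwards [hEt.eventually (hU.mem_nhds hv), hL.eventually (Metric.ball_mem_nhds 0 one_pos)]
    with w hw1 hw2
  refine ⟨hw1, funext fun j => ?_⟩
  obtain ⟨n, hn⟩ := exp_eq_exp_iff_exists_int.1 (hlog.exp_eq _ hw1 j)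
  have hlt : ‖logv (fun j => exp (w j)) j - w j‖ < 1 :=
    (norm_le_pi_norm (logv (fun j => exp (w j)) - w) j).trans_lt (by simpa using hw2)
  rw [hn, add_sub_cancel_left, norm_mul, norm_intCast] at hlt
  have hpi : (1 : ℝ) ≤ ‖2 * (Real.pi : ℂ) * I‖ := by
    simp [abs_of_pos Real.pi_pos]
    linarith [Real.pi_gt_three]
  have hn0 : n = 0 := by
    by_contra h0
    have : (1 : ℝ) ≤ |(n : ℝ)| := by exact_mod_cast Int.one_le_abs h0
    nlinarith
  rw [hn, hn0]
  simp

lemma IsLogBranch.ne_zero (hlog : IsLogBranch U logv) {v : Fin N → ℂ} (hv : v ∈ U) (j : Fin N) :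
    v j ≠ 0 := by
  rw [← hlog.exp_eq v hv j]; exact exp_ne_zero _

lemma IsLogBranch.hasFDerivAt (hlog : IsLogBranch U logv) (hU : IsOpen U) {v : Fin N → ℂ}
    (hv : v ∈ U) :
    HasFDerivAt logv (ContinuousLinearMap.pi fun j =>
      (v j)⁻¹ • (ContinuousLinearMap.proj j : (Fin N → ℂ) →L[ℂ] ℂ)) v := by
  -- The principal logarithm of u_j/v_j is differentiable near u = v, where the quotient is 1; g and
  -- `logv` agree near v.
  set g : (Fin N → ℂ) → Fin N → ℂ := fun u j => logv v j + log (u j * (v j)⁻¹) with hg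
  have hgv : g v = logv v := funext fun j => by
    simp [hg, mul_inv_cancel₀ (hlog.ne_zero hv j)]
  have hgd : HasFDerivAt g (ContinuousLinearMap.pi fun j =>
      (v j)⁻¹ • (ContinuousLinearMap.proj j : (Fin N → ℂ) →L[ℂ] ℂ)) v := by
    refine hasFDerivAt_pi.2 fun j => ?_
    have h1 : HasFDerivAt (fun u : Fin N → ℂ => u j * (v j)⁻¹)
        ((v j)⁻¹ • (ContinuousLinearMap.proj j : (Fin N → ℂ) →L[ℂ] ℂ)) v :=
      HasFDerivAt.mul_const (c := fun u : Fin N → ℂ => u j)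
        (ContinuousLinearMap.proj j : (Fin N → ℂ) →L[ℂ] ℂ).hasFDerivAt _
    have h2 := (h1.clog (by simp [mul_inv_cancel₀ (hlog.ne_zero hv j)])).const_add (logv v j)
    simpa [mul_inv_cancel₀ (hlog.ne_zero hv j)] using h2
  refine hgd.congr_of_eventuallyEq ?_
  have ht : Tendsto g (𝓝 v) (𝓝 (logv v)) := by
    simpa only [hgv] using hgd.continuousAt.tendsto
  filter_upwards [ht.eventually (hlog.eventually_leftInverse hU hv), hU.mem_nhds hv]
    with u hu huU
  have hexp : (fun j => exp (g u j)) = u := funext fun j => by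
    have h0 : u j * (v j)⁻¹ ≠ 0 :=
      mul_ne_zero (hlog.ne_zero huU j) (inv_ne_zero (hlog.ne_zero hv j))
    simp only [hg]
    rw [exp_add, exp_log h0, hlog.exp_eq v hv]
    field_simp [hlog.ne_zero hv j]
  rw [hexp] at hu
  exact hu.2

lemma IsLogBranch.isDominated (hlog : IsLogBranch U logv) (hU : IsOpen U) {γ : Fin N → ℝ}
    (hγ : ∀ j, γ j < 0) (hconv : ∀ v ∈ U, MBConverges B γ (logv v)) {v : Fin N → ℂ} (hv : v ∈ U) :
    IsDominated B γ (logv v) := by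
  refine isDominated_of_eventually hγ ?_
  filter_upwards [hlog.eventually_leftInverse hU hv] with w hw
  rw [← hw.2]
  exact hconv _ hw.1

/-- The derivative of the Mellin–Barnes integral lowers one exponent by `1`. -/
theorem hasFDerivAt_mbInt_logBranch (hlog : IsLogBranch U logv) (hU : IsOpen U) {γ : Fin N → ℝ}
    (hγ : ∀ j, γ j < 0) (hconv : ∀ v ∈ U, MBConverges B γ (logv v)) {ζ : Fin N → ℂ}
    (hζ : ∀ j, (ζ j).re < 0) {v : Fin N → ℂ} (hv : v ∈ U) :
    HasFDerivAt (fun v => mbInt B ζ (logv v))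
      (∑ j, (-mbInt B (ζ - Pi.single j (1 : ℂ)) (logv v)) •
        (ContinuousLinearMap.proj j : (Fin N → ℂ) →L[ℂ] ℂ)) v := by
  have h := (hasFDerivAt_mbInt hγ (hlog.isDominated hU hγ hconv hv) hζ).comp v
    (hlog.hasFDerivAt hU hv)
  refine h.congr_fderiv ?_
  ext x
  simp only [ContinuousLinearMap.comp_apply, neg_apply, sum_apply, smul_apply,
    ContinuousLinearMap.proj_apply, ContinuousLinearMap.pi_apply, smul_eq_mul,
    hlog.exp_eq v hv, ← Finset.sum_neg_distrib]
  refine Finset.sum_congr rfl fun j _ => ?_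
  have := hlog.ne_zero hv j
  field_simp

end LogBranch

end Integral

/-! ### Derivatives of all orders. -/

section Shift

variable {d N : ℕ} {B : Matrix (Fin d) (Fin N) ℤ} {U : Set (Fin N → ℂ)}
  {logv : (Fin N → ℂ) → Fin N → ℂ} {γ : Fin N → ℝ}

/-- The derivative is built from integrals of the same kind with lowered exponents, so the induction
must run over all ζ at once. -/
theorem contDiffOn_mbInt_logBranch (hlog : IsLogBranch U logv) (hU : IsOpen U)
    (hγ : ∀ j, γ j < 0) (hconv : ∀ v ∈ U, MBConverges B γ (logv v)) (n : ℕ) {ζ : Fin N → ℂ}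
    (hζ : ∀ j, (ζ j).re < 0) : ContDiffOn ℂ n (fun v => mbInt B ζ (logv v)) U := by
  induction n generalizing ζ with
  | zero =>
    exact contDiffOn_zero.2 fun v hv =>
      (hasFDerivAt_mbInt_logBranch hlog hU hγ hconv hζ hv).continuousAt.continuousWithinAt
  | succ n ih =>
    rw [Nat.cast_succ, contDiffOn_succ_iff_hasFDerivWithinAt_of_uniqueDiffOn hU.uniqueDiffOn]
    refine ⟨fun h => absurd h (by simp), _, ?_, fun v hv =>
      (hasFDerivAt_mbInt_logBranch hlog hU hγ hconv hζ hv).hasFDerivWithinAt⟩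
    exact ContDiffOn.sum fun j _ => (ih (re_sub_single_neg hζ j)).neg.smul contDiffOn_const

/-- `f` is on `U` the multiple `c · M_ζ` of a Mellin–Barnes integral with negative exponents. -/
def IsMBMultiple (B : Matrix (Fin d) (Fin N) ℤ) (U : Set (Fin N → ℂ))
    (logv : (Fin N → ℂ) → Fin N → ℂ) (f : (Fin N → ℂ) → ℂ) (c : ℂ) (ζ : Fin N → ℂ) : Prop :=
  (∀ j, (ζ j).re < 0) ∧ ∀ v ∈ U, f v = c * mbInt B ζ (logv v)

lemma IsMBMultiple.partialD (hlog : IsLogBranch U logv) (hU : IsOpen U)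
    (hγ : ∀ j, γ j < 0) (hconv : ∀ v ∈ U, MBConverges B γ (logv v)) {f : (Fin N → ℂ) → ℂ} {c : ℂ}
    {ζ : Fin N → ℂ} (hf : IsMBMultiple B U logv f c ζ) (j : Fin N) :
    IsMBMultiple B U logv (partialD j f) (-c) (ζ - Pi.single j (1 : ℂ)) := by
  refine ⟨re_sub_single_neg hf.1 j, fun v hv => ?_⟩
  have hEq : f =ᶠ[𝓝 v] fun v => c * mbInt B ζ (logv v) :=
    Filter.eventually_of_mem (hU.mem_nhds hv) hf.2
  have hd := (hasFDerivAt_mbInt_logBranch hlog hU hγ hconv hf.1 hv).const_mul c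
  rw [AHyp.partialD, hEq.fderiv_eq, hd.fderiv]
  simp [Pi.single_apply]

lemma IsMBMultiple.iterate_partialD (hlog : IsLogBranch U logv) (hU : IsOpen U)
    (hγ : ∀ j, γ j < 0) (hconv : ∀ v ∈ U, MBConverges B γ (logv v)) {f : (Fin N → ℂ) → ℂ} {c : ℂ}
    {ζ : Fin N → ℂ} (hf : IsMBMultiple B U logv f c ζ) (j : Fin N) (n : ℕ) :
    IsMBMultiple B U logv ((AHyp.partialD j)^[n] f) ((-1) ^ n * c)
      (ζ - Pi.single j (n : ℂ)) := by
  induction n with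
  | zero => simpa using hf
  | succ n ih =>
    rw [Function.iterate_succ_apply']
    have h := ih.partialD hlog hU hγ hconv j
    rwa [sub_sub, ← Pi.single_add, ← Nat.cast_succ,
      show -((-1) ^ n * c) = (-1) ^ (n + 1) * c by ring] at h

lemma IsMBMultiple.monomialD (hlog : IsLogBranch U logv) (hU : IsOpen U)
    (hγ : ∀ j, γ j < 0) (hconv : ∀ v ∈ U, MBConverges B γ (logv v)) {f : (Fin N → ℂ) → ℂ} {c : ℂ}
    {ζ : Fin N → ℂ} (hf : IsMBMultiple B U logv f c ζ) (k : Fin N → ℕ) :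
    IsMBMultiple B U logv (monomialD k f) ((-1) ^ (∑ j, k j) * c) (fun j => ζ j - k j) := by
  have key : ∀ l : List (Fin N), IsMBMultiple B U logv
      (l.foldr (fun j g => (AHyp.partialD j)^[k j] g) f) ((-1) ^ (l.map k).sum * c)
      (ζ - (l.map fun j => Pi.single j (k j : ℂ)).sum) := by
    intro l
    induction l with
    | nil => simpa using hf
    | cons j l ih =>
      have h := ih.iterate_partialD hlog hU hγ hconv j (k j)
      rw [List.foldr_cons, List.map_cons, List.sum_cons, List.map_cons, List.sum_cons, pow_add,
        mul_assoc]
      rwa [sub_sub, add_comm (List.sum _)] at h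
  have h := key (List.finRange N)
  rw [← Fin.sum_univ_def, ← Fin.sum_univ_def, Finset.univ_sum_single] at h
  exact h

end Shift

/-! ### The homogeneity and box equations. -/

section System

variable {r N : ℕ} {A : Matrix (Fin r) (Fin N) ℤ} {B : Matrix (Fin (N - r)) (Fin N) ℤ}

lemma IsAMatrix.sum_eq_zero (hA : IsAMatrix A) {l : Fin N → ℤ} (hl : l ∈ relationLattice A) :
    ∑ j, l j = 0 := by
  obtain ⟨h, hh⟩ := hA.exists_form
  have h0 : ∑ j, (l j : ℝ) • (fun i => (A i j : ℝ)) = 0 := by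
    funext i
    have : (A.mulVec l) i = 0 := congrFun (LinearMap.mem_ker.1 hl) i
    simp only [Matrix.mulVec, dotProduct] at this
    simp only [Finset.sum_apply, Pi.smul_apply, smul_eq_mul, Pi.zero_apply]
    simp only [mul_comm]
    exact_mod_cast this
  have h1 := congrArg h h0
  simp only [map_sum, map_smul, hh, smul_eq_mul, mul_one, map_zero] at h1
  exact_mod_cast h1

lemma IsBMatrix.exists_realDot_eq (hB : IsBMatrix A B) {l : Fin N → ℤ}
    (hl : l ∈ relationLattice A) : ∃ m : Fin (N - r) → ℝ, ∀ j, realDot B m j = l j := by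
  rw [← hB.span_row] at hl
  obtain ⟨m, hm⟩ := (Submodule.mem_span_range_iff_exists_fun ℤ).1 hl
  refine ⟨fun k => m k, fun j => ?_⟩
  rw [← hm]
  simp [realDot, Matrix.row, mul_comm]

lemma IsBMatrix.sum_mul_realDot (hB : IsBMatrix A B) (τ : Fin (N - r) → ℝ) (i : Fin r) :
    ∑ j, (A i j : ℝ) * realDot B τ j = 0 := by
  have hrow : ∀ k, ∑ j, (A i j : ℝ) * B k j = 0 := fun k => by
    have hmem : B.row k ∈ relationLattice A := by
      rw [← hB.span_row]; exact Submodule.subset_span ⟨k, rfl⟩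
    have : (A.mulVec (B.row k)) i = 0 := congrFun (LinearMap.mem_ker.1 hmem) i
    simp only [Matrix.mulVec, dotProduct, Matrix.row] at this
    exact_mod_cast this
  simp only [realDot, Finset.mul_sum]
  rw [Finset.sum_comm]
  refine Finset.sum_eq_zero fun k _ => ?_
  simp only [← mul_assoc, ← Finset.sum_mul, hrow, zero_mul]

/-- Under the integral, exp(w_j) times the lowered integrand is -(γ_j + b_j·s) times the original
one, and the rows of A are orthogonal to those of B. -/
lemma sum_mul_exp_mul_mbInt (hB : IsBMatrix A B) {α : Fin r → ℝ} {γ : Fin N → ℝ}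
    (hγα : ∀ i, ∑ j, γ j * (A i j : ℝ) = α i) (hγ : ∀ j, γ j < 0) {w : Fin N → ℂ}
    (h : IsDominated B γ w) (i : Fin r) :
    ∑ j, (A i j : ℂ) * (exp (w j) * mbInt B ((fun j => (γ j : ℂ)) - Pi.single j (1 : ℂ)) w) =
      -(α i * mbInt B (fun j => (γ j : ℂ)) w) := by
  have hγ' : ∀ j, ((fun j => (γ j : ℂ)) j).re < 0 := fun j => by simpa using hγ j
  simp only [mbInt, ← integral_const_mul, ← integral_neg]
  rw [← integral_finsetSum _ fun j _ =>
    ((h.integrable hγ (re_sub_single_neg hγ' j)).const_mul _).const_mul _]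
  congr 1
  funext τ
  have hsum : ∑ j, (A i j : ℂ) * (γ j + I * realDot B τ j) = α i := by
    have h1 : ∑ j, (A i j : ℂ) * (realDot B τ j : ℂ) = 0 := by
      exact_mod_cast hB.sum_mul_realDot τ i
    have h2 : ∑ j, (A i j : ℂ) * (γ j : ℂ) = α i := by
      rw [← hγα i]
      push_cast
      exact Finset.sum_congr rfl fun j _ => mul_comm _ _
    simp only [mul_add, Finset.sum_add_distrib, h2, mul_left_comm _ I, ← Finset.mul_sum, h1]
    simp
  rw [← hsum, Finset.sum_mul, ← Finset.sum_neg_distrib]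
  refine Finset.sum_congr rfl fun j _ => ?_
  rw [exp_mul_mbProd_sub_single hγ']
  ring

/-- With l = l⁺ - l⁻ written as (b_j·m)_j, shifting the contour by m carries γ - l⁺ to γ - l⁻; both
are negative in every coordinate. -/
lemma mbInt_sub_toNat (hB : IsBMatrix A B) {γ : Fin N → ℝ} (hγ : ∀ j, γ j < 0) {w : Fin N → ℂ}
    (h : IsDominated B γ w) {l : Fin N → ℤ} (hl : l ∈ relationLattice A) :
    mbInt B (fun j => (γ j : ℂ) - ((l j).toNat : ℂ)) w =
      mbInt B (fun j => (γ j : ℂ) - ((-l j).toNat : ℂ)) w := by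
  obtain ⟨m, hm⟩ := hB.exists_realDot_eq hl
  have hcast : ∀ j, γ j - ((l j).toNat : ℝ) + realDot B m j = γ j - ((-l j).toNat : ℝ) := fun j => by
    have : ((l j).toNat : ℝ) - ((-l j).toNat : ℝ) = l j := by
      exact_mod_cast Int.toNat_sub_toNat_neg (l j)
    rw [hm, ← this]; ring
  have hneg : ∀ n : ℕ, ∀ j, γ j - (n : ℝ) < 0 := fun n j => by
    linarith [hγ j, n.cast_nonneg (α := ℝ)]
  have key := mbInt_add_realDot hγ h (c := fun j => γ j - ((l j).toNat : ℝ)) (m := m)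
    (fun j => hneg _ j) (fun j => by simpa only [hcast] using hneg _ j)
  simp only [hcast] at key
  push_cast at key
  exact key.symm

end System

end AHyp

theorem theorem2 {r N : ℕ} (A : Matrix (Fin r) (Fin N) ℤ) (hA : AHyp.IsAMatrix A)
    (B : Matrix (Fin (N - r)) (Fin N) ℤ) (hB : AHyp.IsBMatrix A B)
    (α : Fin r → ℝ) (γ : Fin N → ℝ) (hγα : ∀ i, ∑ j, γ j * (A i j : ℝ) = α i)
    (hγ : ∀ j, γ j < 0)
    (U : Set (Fin N → ℂ)) (hU : IsOpen U)
    (logv : (Fin N → ℂ) → Fin N → ℂ) (hlog : AHyp.IsLogBranch U logv)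
    (hconv : ∀ v ∈ U, AHyp.MBConverges B γ (logv v)) :
    AHyp.IsSolution A α U (fun v => AHyp.mbIntegral B γ (logv v)) := by
  have hγ' : ∀ j, ((γ j : ℂ)).re < 0 := fun j => by simpa using hγ j
  have hM : AHyp.IsMBMultiple B U logv (fun v => AHyp.mbIntegral B γ (logv v))
      (Complex.I ^ (N - r)) (fun j => (γ j : ℂ)) := ⟨hγ', fun v _ => AHyp.mbIntegral_eq B γ _⟩
  refine ⟨?_, fun i v hv => ?_, fun l hl v hv => ?_⟩
  · simp only [AHyp.mbIntegral_eq]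
    exact contDiffOn_infty.2 fun n => contDiffOn_const.mul
      (AHyp.contDiffOn_mbInt_logBranch hlog hU hγ hconv n hγ')
  · have hsum := AHyp.sum_mul_exp_mul_mbInt hB hγα hγ (hlog.isDominated hU hγ hconv hv) i
    simp only [hlog.exp_eq v hv] at hsum
    simp only [AHyp.eulerOp]
    rw [Finset.sum_congr rfl fun j _ =>
      congrArg _ ((hM.partialD hlog hU hγ hconv j).2 v hv), AHyp.mbIntegral_eq]
    rw [Finset.sum_congr rfl fun j _ => show _ = -Complex.I ^ (N - r) * ((A i j : ℂ) *
      (v j * AHyp.mbInt B ((fun j => (γ j : ℂ)) - Pi.single j (1 : ℂ)) (logv v))) by ring,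
      ← Finset.mul_sum, hsum]
    ring
  -- Equal degrees make the signs (-1)^{|k|} of the two monomials agree.
  · have hdeg : ∑ j, (l j).toNat = ∑ j, (-l j).toNat := by
      have h0 := hA.sum_eq_zero hl
      rw [Finset.sum_congr rfl fun j _ => (Int.toNat_sub_toNat_neg (l j)).symm,
        Finset.sum_sub_distrib, sub_eq_zero] at h0
      exact_mod_cast h0
    rw [AHyp.boxOp, (hM.monomialD hlog hU hγ hconv _).2 v hv,
      (hM.monomialD hlog hU hγ hconv _).2 v hv, hdeg,
      AHyp.mbInt_sub_toNat hB hγ (hlog.isDominated hU hγ hconv hv) hl, sub_self]
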